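/- Let $R$ be a regular ring (commutative and Noetherian, not necessarily local) of prime characteristic $p>0$ that is $F$-finite, i.e. the Frobenius homomorphism $x\mapsto x^p$ of $R$ is finite. For an ideal $J\subseteq R$ and an integer $e\ge 0$ let $J^{[p^e]}$ be the ideal generated by all $u^{p^e}$ with $u\in J$, and for an ideal $\mathfrak b$ let $\mathfrak b^{[1/p^e]}$ be the smallest ideal $J$ of $R$ with $\mathfrak b\subseteq J^{[p^e]}$ (so $\mathfrak b^{[1/p^0]}=\mathfrak b$). For an ideal $\mathfrak a\subseteq R$ and real $c>0$ let $$\tau(\mathfrak a^c)=\bigcup_{e>0}\left(\mathfrak a^{\lceil cp^e\rceil}\right)^{[1/p^e]}.$$ For $c=0$ write $R=R_1\times\cdots\times R_m$ with regular domains $R_i$, and correspondingly $\mathfrak a=\mathfrak a_1\times\cdots\times\mathfrak a_m$; set $\tau(\mathfrak a^0)=\tau(\mathfrak a_1^0)\times\cdots\times\tau(\mathfrak a_m^0)$, where $\tau(\mathfrak a_i^0)=R_i$ if $\mathfrak a_i\neq(0)$ and $\tau(\mathfrak a_i^0)=(0)$ if $\mathfrak a_i=(0)$. Then for every ideal $\mathfrak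 a$ of $R$ and every real $c\ge 0$ there is $\varepsilon>0$ such that: 1. for all integers $r,e\ge 0$ with $c<\frac{r}{p^e}<c+\varepsilon$ we have $\tau(\mathfrak a^c)=(\mathfrak a^r)^{[1/p^e]}$ and $\tau(\mathfrak a^c)=\tau(\mathfrak a^{r/p^e})$; 2. $\tau(\mathfrak a^{c'})=\tau(\mathfrak a^c)$ for every real $c'\in[c,c+\varepsilon)$, i.e. the family $\tau(\mathfrak a^c)$ is right continuous in $c$. -/

import Mathlib

namespace GenTestIdeal

/-- The Frobenius (bracket) power `J^{[q]}`: the ideal generated by the `q`-th powers of the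
elements of `J`. It is used for `q = p ^ e` in a ring of characteristic `p`. -/
def bracketPow {R : Type*} [CommRing R] (J : Ideal R) (q : ℕ) : Ideal R :=
  Ideal.span {x : R | ∃ u ∈ J, x = u ^ q}

/-- The ideal `𝔟^{[1/q]}`: the smallest ideal `J` with `𝔟 ⊆ J^{[q]}`, that is, the intersection
of all such `J`. (Over an `F`-finite regular ring of characteristic `p`, with `q = p ^ e`, this
intersection belongs to the family. For `q = 1` one gets `𝔟` itself.) -/
def bracketRoot {R : Type*} [CommRing R] (b : Ideal R) (q : ℕ) : Ideal R :=
  sInf {J : Ideal R | b ≤ bracketPow J q}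

open Classical in
/-- The convention for exponent `0` over a domain: the whole ring, unless the ideal is zero,
in which case it is the zero ideal. -/
noncomputable def zeroExpDomain {D : Type*} [CommRing D] (a : Ideal D) : Ideal D :=
  if a = ⊥ then ⊥ else ⊤

/-- The convention for exponent `0` in general. A regular ring `R` is the product of the domains
`R ⧸ P`, `P` running over the (finitely many) minimal primes, and `τ(𝔞^0)` is the product of the
ideals `τ(𝔞_P^0)`, where `𝔞_P` is the component (image) of `𝔞` in `R ⧸ P`: an element of `R`
belongs to it iff each of its components belongs to `τ(𝔞_P^0)`. -/
noncomputable def zeroExp {R : Type*} [CommRing R] (a : Ideal R) : Ideal R :=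
  ⨅ P ∈ minimalPrimes R,
    (zeroExpDomain (a.map (Ideal.Quotient.mk P))).comap (Ideal.Quotient.mk P)

open Classical in
/-- The generalized test ideal `τ(𝔞^c)` in characteristic `p`, for real `c ≥ 0`: for `c > 0` the
union (of an increasing chain, hence the supremum) over `e > 0` of `(𝔞^⌈c p^e⌉)^{[1/p^e]}`. -/
noncomputable def testIdeal {R : Type*} [CommRing R] (p : ℕ) (a : Ideal R) (c : ℝ) : Ideal R :=
  if c = 0 then zeroExp a
  else ⨆ (e : ℕ) (_ : 0 < e), bracketRoot (a ^ ⌈c * (p : ℝ) ^ e⌉₊) (p ^ e)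

end GenTestIdeal

/-!
Let `q = p ^ e`. The statement rests on two facts on Frobenius powers of ideals in an `F`-finite
regular ring `R`: they commute with arbitrary intersections, so that `𝔟 ⊆ (𝔟^{[1/q]})^{[q]}`
(`GenTestIdeal.le_bracketPow_bracketRoot`), and with colons, `(K : u)^{[q]} = (K^{[q]} : u ^ q)`
(`GenTestIdeal.bracketPow_colon_singleton`). As `J^{[q]}` is the extension of `J` along the `e`-th
iterate of the Frobenius, both hold because `R` is a finite projective module over itself through
the Frobenius, i.e. because of Kunz's theorem (`IsRegularRing.flat_frobenius`). Kunz's theorem is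
local. Over a regular local ring, the maximal ideal is generated by a regular sequence
`x₁, …, x_d`; then `x₁ ^ p, …, x_d ^ p` is regular as well, which says that `x₁, …, x_d` is regular
on `R` viewed as a module through the Frobenius, and a finite module with this property is free
(`Module.free_of_isWeaklyRegular_of_ofList_eq_maximalIdeal`).

By the fact on colons, `(𝔞^r)^{[1/p^e]} ⊆ (𝔞^s)^{[1/p^(e+k)]}` whenever `s / p ^ (e + k) ≤ r / p ^ e`.
As `R` is Noetherian, the ideals `(𝔞^r)^{[1/p^e]}` with `c < r / p ^ e < c + ε` are therefore all
equal to one ideal `I` if `ε` is small (`GenTestIdeal.exists_forall_bracketRoot_eq`). For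
`c ≤ c' < c + ε` and large `e`, the ideal `(𝔞^⌈c' p^e⌉)^{[1/p^e]}` is among them, unless `c' = c` and
`c = r / p ^ e` is itself a fraction. If this is so and `r > 0`, then
`𝔞^(r p^k + 1) ⊆ I^{[p^(e+k)]}` for all large `k`, and by the fact on colons and Krull's
intersection theorem the additional factor `𝔞` can be dropped: `𝔞^r ⊆ I^{[p^e]}`
(`GenTestIdeal.pow_le_bracketPow_of_eventually`). For exponent `0` the same argument shows that `I`
is the intersection of the minimal primes containing `𝔞` (`GenTestIdeal.zeroExp_eq_of_eventually`),
which is how the convention for `τ(𝔞^0)` reads in the ring `R`.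
-/

/-! ### Powers of weakly regular sequences -/

section PowersOfRegularSequences

open RingTheory.Sequence Pointwise Function

/-- Weak regularity of a sequence passes to extensions: for `0 → M₁ → M₂ → M₃ → 0` exact, a
sequence that is weakly regular on `M₁` and on `M₃` is weakly regular on `M₂`. -/
lemma RingTheory.Sequence.IsWeaklyRegular.of_exact {R : Type*} [CommRing R] (rs : List R) :
    ∀ {M₁ M₂ M₃ : Type _} [AddCommGroup M₁] [AddCommGroup M₂] [AddCommGroup M₃]
      [Module R M₁] [Module R M₂] [Module R M₃] {f : M₁ →ₗ[R] M₂} {g : M₂ →ₗ[R] M₃},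
      Injective f → Exact f g → Surjective g →
      IsWeaklyRegular M₁ rs → IsWeaklyRegular M₃ rs → IsWeaklyRegular M₂ rs := by
  induction rs with
  | nil => intros; exact .nil _ _
  | cons r rs ih =>
    intro M₁ M₂ M₃ _ _ _ _ _ _ f g hf hfg hg h₁ h₃
    rw [isWeaklyRegular_cons_iff] at h₁ h₃ ⊢
    refine ⟨isSMulRegular_of_range_eq_ker hf hfg.linearMap_ker_eq.symm h₁.1 h₃.1, ?_⟩
    have h0 : Exact (0 : Unit →ₗ[R] M₁) f := (f.exact_zero_iff_injective Unit).mpr hf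
    have hex := QuotSMulTop.map_first_exact_on_four_term_exact_of_isSMulRegular_last
      h0 hfg h₃.1
    rw [map_zero] at hex
    have hinj := ((QuotSMulTop.map r f).exact_zero_iff_injective _).mp hex
    exact ih hinj (QuotSMulTop.map_exact r hfg hg) (QuotSMulTop.map_surjective r hg) h₁.2 h₃.2

/-- If `x` is a nonzerodivisor on `M` and `rs` is weakly regular on `M ⧸ xM`, then `rs` is weakly
regular on `M ⧸ xⁿM`, which is an iterated extension of copies of `M ⧸ xM`. -/
lemma RingTheory.Sequence.IsWeaklyRegular.quotSMulTop_pow {R M : Type*} [CommRing R]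
    [AddCommGroup M] [Module R M] {x : R} {rs : List R} (hx : IsSMulRegular M x)
    (h : IsWeaklyRegular (QuotSMulTop x M) rs) (n : ℕ) :
    IsWeaklyRegular (QuotSMulTop (x ^ n) M) rs := by
  induction n with
  | zero =>
    have : Subsingleton (QuotSMulTop (x ^ 0) M) := by
      rw [Submodule.Quotient.subsingleton_iff]
      simp
    refine ⟨fun i hi ↦ ?_⟩
    exact fun _ _ _ ↦ Subsingleton.elim _ _
  | succ n ih =>
    let f : QuotSMulTop (x ^ n) M →ₗ[R] QuotSMulTop (x ^ (n + 1)) M :=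
      Submodule.mapQ _ _ (LinearMap.lsmul R M x) (by
        rintro _ ⟨m, -, rfl⟩
        exact ⟨m, trivial, by simp [pow_succ', mul_smul, smul_comm x (x ^ n)]⟩)
    let g : QuotSMulTop (x ^ (n + 1)) M →ₗ[R] QuotSMulTop x M :=
      Submodule.mapQ _ _ LinearMap.id (by
        rintro _ ⟨m, -, rfl⟩
        exact ⟨x ^ n • m, trivial, by simp [pow_succ, mul_smul]⟩)
    refine IsWeaklyRegular.of_exact rs (f := f) (g := g) ?_ ?_ ?_ ih h
    · rw [← LinearMap.ker_eq_bot, LinearMap.ker_eq_bot']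
      intro m hm
      obtain ⟨m, rfl⟩ := Submodule.Quotient.mk_surjective _ m
      simp only [f, Submodule.mapQ_apply, Submodule.Quotient.mk_eq_zero] at hm ⊢
      obtain ⟨y, -, hy⟩ := hm
      refine ⟨y, trivial, hx ?_⟩
      simpa [pow_succ, mul_smul, smul_comm x (x ^ n)] using hy
    · intro m
      obtain ⟨m, rfl⟩ := Submodule.Quotient.mk_surjective _ m
      constructor
      · intro hm
        simp only [g, Submodule.mapQ_apply, Submodule.Quotient.mk_eq_zero] at hm
        obtain ⟨y, -, hy⟩ := hm
        exact ⟨Submodule.Quotient.mk y, congrArg Submodule.Quotient.mk hy⟩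
      · rintro ⟨y, hy⟩
        obtain ⟨y, rfl⟩ := Submodule.Quotient.mk_surjective _ y
        rw [← hy]
        simp only [f, g, Submodule.mapQ_apply, Submodule.Quotient.mk_eq_zero]
        exact ⟨y, trivial, rfl⟩
    · intro m
      obtain ⟨m, rfl⟩ := Submodule.Quotient.mk_surjective _ m
      exact ⟨Submodule.Quotient.mk m, rfl⟩

lemma RingTheory.Sequence.IsWeaklyRegular.map_pow {R : Type*} [CommRing R] (n : ℕ) (rs : List R) :
    ∀ {M : Type _} [AddCommGroup M] [Module R M],
      IsWeaklyRegular M rs → IsWeaklyRegular M (rs.map (· ^ n)) := by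
  induction rs with
  | nil => intros; exact .nil _ _
  | cons r rs ih =>
    intro M _ _ h
    rw [isWeaklyRegular_cons_iff] at h
    rw [List.map_cons, isWeaklyRegular_cons_iff]
    exact ⟨h.1.pow n, ih (IsWeaklyRegular.quotSMulTop_pow h.1 h.2 n)⟩

end PowersOfRegularSequences

/-! ### Regular local rings -/

section RegularLocalRings

open RingTheory.Sequence IsLocalRing

/-- In a Noetherian local ring, an element of `𝔪 \ 𝔪²` belongs to a minimal system of generators
of `𝔪`: killing it lowers the embedding dimension. -/
lemma IsLocalRing.spanFinrank_maximalIdeal_quotient_add_one_le {R : Type*} [CommRing R]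
    [IsLocalRing R] [IsNoetherianRing R] {x : R} (hx : x ∈ maximalIdeal R)
    (hx2 : x ∉ maximalIdeal R ^ 2) [IsLocalRing (R ⧸ Ideal.span {x})] :
    (maximalIdeal (R ⧸ Ideal.span {x})).spanFinrank + 1 ≤ (maximalIdeal R).spanFinrank := by
  classical
  set 𝔪 := maximalIdeal R
  set k := ResidueField R
  let v : CotangentSpace R := 𝔪.toCotangent ⟨x, hx⟩
  have hv : v ≠ 0 := fun h ↦ hx2 ((𝔪.toCotangent_eq_zero ⟨x, hx⟩).mp h)
  have hli : LinearIndepOn k id ({v} : Set (CotangentSpace R)) := .singleton hv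
  let B := hli.extend (Set.subset_univ _)
  have hvB : v ∈ B := hli.subset_extend _ rfl
  let b : Module.Basis B k (CotangentSpace R) := .extend hli
  have : Fintype B := FiniteDimensional.fintypeBasisIndex b
  have hcard : B.ncard = 𝔪.spanFinrank := by
    rw [spanFinrank_maximalIdeal_eq_finrank_cotangentSpace, Module.finrank_eq_card_basis b,
      Set.ncard_eq_toFinset_card', Set.toFinset_card]
  obtain ⟨g, hg⟩ := 𝔪.toCotangent_surjective.hasRightInverse
  -- lifts of the basis vectors, with `x` as the lift of `v`
  let s : Set 𝔪 := insert ⟨x, hx⟩ (g '' (B \ {v}))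
  have hs : 𝔪.toCotangent '' s = B := by
    rw [Set.image_insert_eq, ← Set.image_comp, hg.id, Set.image_id]
    change insert v (B \ {v}) = B
    rw [Set.insert_sdiff_singleton, Set.insert_eq_of_mem hvB]
  have hspan : Submodule.span R s = ⊤ := by
    rw [← CotangentSpace.span_image_eq_top_iff, hs]
    have := b.span_eq
    rwa [Module.Basis.range_extend] at this
  have h𝔪 : Ideal.span (insert x ((fun z ↦ (g z : R)) '' (B \ {v}))) = 𝔪 := by
    have := congrArg (Submodule.map 𝔪.subtype) hspan
    rw [Submodule.map_span, Submodule.map_top, Submodule.range_subtype, Set.image_insert_eq,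
      ← Set.image_comp] at this
    exact this
  have hmap : maximalIdeal (R ⧸ Ideal.span {x}) =
      Ideal.span (Ideal.Quotient.mk (Ideal.span {x}) '' ((fun z ↦ (g z : R)) '' (B \ {v}))) := by
    have h1 : 𝔪.map (Ideal.Quotient.mk (Ideal.span {x})) = maximalIdeal (R ⧸ Ideal.span {x}) :=
      map_maximalIdeal_of_surjective _ Ideal.Quotient.mk_surjective
    rw [← h1, ← congrArg (Ideal.map (Ideal.Quotient.mk (Ideal.span {x}))) h𝔪, Ideal.map_span,
      Set.image_insert_eq]
    have : Ideal.Quotient.mk (Ideal.span {x}) x = 0 :=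
      Ideal.Quotient.eq_zero_iff_mem.mpr (Ideal.mem_span_singleton_self x)
    rw [this]
    exact Submodule.span_insert_zero
  have hfin : (B \ {v}).Finite := B.toFinite.sdiff
  rw [hmap, ← hcard, ← Set.ncard_sdiff_singleton_add_one hvB]
  gcongr
  exact (Submodule.spanFinrank_span_le_ncard_of_finite ((hfin.image _).image _)).trans
    ((Set.ncard_image_le (hfin.image _)).trans (Set.ncard_image_le hfin))

/-- Killing an element of `𝔪 \ 𝔪²` in a regular local ring yields a regular local ring whose
dimension is smaller by one. -/
lemma IsRegularLocalRing.quotient_span_singleton {R : Type*} [CommRing R] [IsRegularLocalRing R]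
    {x : R} (hx : x ∈ maximalIdeal R) (hx2 : x ∉ maximalIdeal R ^ 2) :
    IsRegularLocalRing (R ⧸ Ideal.span {x}) ∧
      ringKrullDim (R ⧸ Ideal.span {x}) + 1 = ringKrullDim R := by
  have hne : Ideal.span {x} ≠ ⊤ :=
    ne_top_of_le_ne_top Ideal.IsPrime.ne_top' ((Ideal.span_singleton_le_iff_mem _).mpr hx)
  have : Nontrivial (R ⧸ Ideal.span {x}) := Ideal.Quotient.nontrivial_iff.mpr hne
  have : IsLocalRing (R ⧸ Ideal.span {x}) :=
    .of_surjective' (Ideal.Quotient.mk _) Ideal.Quotient.mk_surjective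
  have h1 := spanFinrank_maximalIdeal_quotient_add_one_le hx hx2
  have h2 : ringKrullDim R ≤ ringKrullDim (R ⧸ Ideal.span {x}) + 1 := by
    simpa using ringKrullDim_le_ringKrullDim_quotient_add_encard {x} (by
      simpa [IsLocalRing.ringJacobson_eq_maximalIdeal] using hx)
  have h3 := ringKrullDim_le_spanFinrank_maximalIdeal (R ⧸ Ideal.span {x})
  rw [← IsRegularLocalRing.spanFinrank_maximalIdeal (R := R)] at h2 ⊢
  have h4 : ((maximalIdeal (R ⧸ Ideal.span {x})).spanFinrank : WithBot ℕ∞) + 1 ≤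
      (maximalIdeal R).spanFinrank := by exact_mod_cast h1
  have h5 : ringKrullDim (R ⧸ Ideal.span {x}) + 1 ≤
      (maximalIdeal (R ⧸ Ideal.span {x})).spanFinrank + 1 := by gcongr
  refine ⟨.of_spanFinrank_maximalIdeal_le _ ?_, le_antisymm (h5.trans h4) h2⟩
  exact ENat.WithBot.add_le_add_one_right_iff.mp (h4.trans h2)

/-- A regular local ring is a domain, and its maximal ideal is generated by a regular sequence.
The two facts are proved together, by induction on the dimension: for `x ∈ 𝔪 \ 𝔪²` outside all
minimal primes, `R ⧸ x` is a domain by induction, so that `xR` is a prime strictly above some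
minimal prime `Q`; then `Q = xQ` vanishes by Nakayama's lemma. -/
lemma IsRegularLocalRing.isDomain_and_exists_isWeaklyRegular (n : ℕ) :
    ∀ (R : Type _) [CommRing R] [IsRegularLocalRing R], ringKrullDim R = n →
      IsDomain R ∧ ∃ rs : List R, Ideal.ofList rs = maximalIdeal R ∧ IsWeaklyRegular R rs := by
  induction n with
  | zero =>
    intro R _ _ hR
    have h := IsRegularLocalRing.spanFinrank_maximalIdeal (R := R)
    rw [hR] at h
    have h0 : maximalIdeal R = ⊥ := (Submodule.spanFinrank_eq_zero_iff_eq_bot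
      (maximalIdeal R).fg_of_isNoetherianRing).mp (by exact_mod_cast h)
    exact ⟨(isField_iff_maximalIdeal_eq.mpr h0).isDomain, [], by simp [h0], .nil _ _⟩
  | succ n ih =>
    intro R _ _ hR
    have hm2 : ¬ maximalIdeal R ≤ maximalIdeal R ^ 2 := by
      intro h
      have h0 : maximalIdeal R = ⊥ := by
        refine Submodule.eq_bot_of_le_smul_of_le_jacobson_bot (maximalIdeal R) _
          (maximalIdeal R).fg_of_isNoetherianRing ?_ (maximalIdeal_le_jacobson _)
        simpa [pow_two] using h
      have h1 := IsRegularLocalRing.spanFinrank_maximalIdeal (R := R)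
      rw [h0, hR, Submodule.spanFinrank_bot] at h1
      exact absurd h1.symm (by exact_mod_cast n.succ_ne_zero)
    have hmin : ∀ Q ∈ minimalPrimes R, ¬ maximalIdeal R ≤ Q := by
      intro Q hQ h
      have hQp := hQ.1.1
      have hQm : maximalIdeal R = Q := (maximalIdeal.isMaximal R).eq_of_le hQp.ne_top h
      have h1 := maximalIdeal_height_eq_ringKrullDim (R := R)
      rw [hR, hQm, Ideal.height_eq_zero_iff.mpr hQ] at h1
      exact absurd h1.symm (by exact_mod_cast n.succ_ne_zero)
    obtain ⟨x, hx, hxU⟩ : ∃ x ∈ maximalIdeal R,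
        x ∉ ⋃ I ∈ insert (maximalIdeal R ^ 2) (minimalPrimes R), (I : Set R) := by
      by_contra! h
      obtain ⟨I, hI, hle⟩ := (Ideal.subset_union_prime_finite
        ((minimalPrimes.finite_of_isNoetherianRing R).insert _) (f := id)
        (maximalIdeal R ^ 2) (maximalIdeal R ^ 2) (by
          rintro I (rfl | hI) h1 -
          · exact absurd rfl h1
          · exact hI.1.1)).mp h
      rcases hI with rfl | hI
      · exact hm2 hle
      · exact hmin I hI hle
    simp only [Set.mem_iUnion, Set.mem_insert_iff, exists_prop, not_exists, not_and] at hxU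
    have hx2 : x ∉ maximalIdeal R ^ 2 := hxU _ (Or.inl rfl)
    obtain ⟨hreg, hdim⟩ := IsRegularLocalRing.quotient_span_singleton hx hx2
    obtain ⟨hdom, rs', hrs', hw⟩ := ih (R ⧸ Ideal.span {x}) (by
      rw [hR, Nat.cast_add, Nat.cast_one] at hdim
      exact ENat.WithBot.add_one_cancel.mp hdim)
    have hprime : (Ideal.span {x}).IsPrime := (Ideal.Quotient.isDomain_iff_prime _).mp hdom
    have hR' : IsDomain R := by
      obtain ⟨Q, hQ, hQx⟩ := Ideal.exists_minimalPrimes_le (bot_le (a := Ideal.span {x}))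
      have hxQ : x ∉ Q := hxU Q (Or.inr hQ)
      have hQp := hQ.1.1
      have : Q = ⊥ := by
        refine Submodule.eq_bot_of_le_smul_of_le_jacobson_bot (maximalIdeal R) _
          Q.fg_of_isNoetherianRing (fun y hy ↦ ?_) (maximalIdeal_le_jacobson _)
        obtain ⟨z, rfl⟩ := Ideal.mem_span_singleton'.mp (hQx hy)
        rw [mul_comm]
        exact Submodule.smul_mem_smul hx ((hQp.mem_or_mem hy).resolve_right hxQ)
      rw [this] at hQp
      exact IsDomain.of_bot_isPrime R
    have hx0 : x ≠ 0 := by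
      rintro rfl
      exact hx2 (zero_mem _)
    obtain ⟨rs, rfl⟩ := List.map_surjective_iff.mpr Ideal.Quotient.mk_surjective rs'
    refine ⟨hR', x :: rs, ?_, IsWeaklyRegular.cons (IsSMulRegular.of_ne_zero hx0) ?_⟩
    · have h1 := congrArg (Ideal.comap (Ideal.Quotient.mk (Ideal.span {x}))) hrs'
      rw [← Ideal.map_ofList, Ideal.comap_map_of_surjective _ Ideal.Quotient.mk_surjective,
        ← RingHom.ker_eq_comap_bot, Ideal.mk_ker] at h1
      rw [Ideal.ofList_cons, sup_comm, h1]
      have : IsLocalHom (Ideal.Quotient.mk (Ideal.span {x})) :=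
        .of_surjective _ Ideal.Quotient.mk_surjective
      exact maximalIdeal_comap _
    · replace hw := (isWeaklyRegular_map_algebraMap_iff (R ⧸ Ideal.span {x}) _ rs).mp hw
      exact ((Submodule.quotEquivOfEq _ _ (by
        rw [← Submodule.ideal_span_singleton_smul, smul_eq_mul, Ideal.mul_top])
        ).isWeaklyRegular_congr rs).mp hw

end RegularLocalRings

/-! ### Freeness of maximal Cohen-Macaulay modules over regular local rings -/

section Freeness

open RingTheory.Sequence IsLocalRing

/-- A finite module over a Noetherian local ring is free if the maximal ideal is generated by a
sequence that is weakly regular on the module. -/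
lemma Module.free_of_isWeaklyRegular_of_ofList_eq_maximalIdeal (n : ℕ) :
    ∀ (R : Type _) [CommRing R] [IsLocalRing R] [IsNoetherianRing R] (M : Type _) [AddCommGroup M]
      [Module R M] [Module.Finite R M] (rs : List R), rs.length = n →
      Ideal.ofList rs = maximalIdeal R → IsWeaklyRegular M rs → Module.Free R M := by
  induction n with
  | zero =>
    intro R _ _ _ M _ _ _ rs hn hm h
    obtain rfl := List.length_eq_zero_iff.mp hn
    rw [Ideal.ofList_nil] at hm
    let := (isField_iff_maximalIdeal_eq.mpr hm.symm).toField
    exact Module.Free.of_divisionRing R M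
  | succ n ih =>
    intro R _ _ _ M _ _ _ rs hn hm h
    obtain ⟨x, rs, rfl⟩ := List.exists_cons_of_length_eq_add_one hn
    have hx : x ∈ maximalIdeal R := by
      rw [← hm]
      exact Ideal.subset_span (by simp)
    rw [isWeaklyRegular_cons_iff'] at h
    have hne : Ideal.span {x} ≠ ⊤ :=
      ne_top_of_le_ne_top Ideal.IsPrime.ne_top' ((Ideal.span_singleton_le_iff_mem _).mpr hx)
    have : Nontrivial (R ⧸ Ideal.span {x}) := Ideal.Quotient.nontrivial_iff.mpr hne
    have : IsLocalRing (R ⧸ Ideal.span {x}) :=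
      .of_surjective' (Ideal.Quotient.mk _) Ideal.Quotient.mk_surjective
    have : Module.Finite (R ⧸ Ideal.span {x}) (QuotSMulTop x M) :=
      Module.Finite.of_restrictScalars_finite R _ _
    have := Module.finitePresentation_of_finite R M
    rw [← Module.free_quotSMulTop_iff_free R M (maximalIdeal_le_jacobson _ hx) h.1]
    refine ih _ _ _ (by simpa using hn) ?_ h.2
    rw [← Ideal.map_ofList, ← map_maximalIdeal_of_surjective _ (Ideal.Quotient.mk_surjective), ← hm,
      Ideal.ofList_cons, Ideal.map_sup, Ideal.map_quotient_self, bot_sup_eq]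

end Freeness

/-! ### Flatness of the Frobenius of a regular ring -/

section FlatFrobenius

open RingTheory.Sequence IsLocalRing

lemma RingHom.Finite.flat_of_isWeaklyRegular {A B : Type*} [CommRing A] [IsLocalRing A]
    [IsNoetherianRing A] [CommRing B] {f : A →+* B} (hf : f.Finite) {rs : List A}
    (hrs : Ideal.ofList rs = maximalIdeal A) (h : IsWeaklyRegular B (rs.map f)) : f.Flat := by
  algebraize [f]
  have h' : IsWeaklyRegular B rs := (isWeaklyRegular_map_algebraMap_iff B B rs).mp h
  have := Module.free_of_isWeaklyRegular_of_ofList_eq_maximalIdeal _ A B rs rfl hrs h'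
  exact inferInstanceAs (Module.Flat A B)

/-- A sequence generating the maximal ideal of a regular local ring stays regular after raising
its members to the `p`-th power, i.e. it is regular on the ring viewed as a module over itself
through the Frobenius; being finite, this module is therefore free. -/
lemma IsRegularLocalRing.flat_frobenius {R : Type*} [CommRing R] [IsRegularLocalRing R] (p : ℕ)
    [ExpChar R p] (hF : (frobenius R p).Finite) : (frobenius R p).Flat := by
  obtain ⟨-, rs, hrs, hw⟩ := IsRegularLocalRing.isDomain_and_exists_isWeaklyRegular _ R
    (IsRegularLocalRing.spanFinrank_maximalIdeal (R := R)).symm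
  exact hF.flat_of_isWeaklyRegular hrs (IsWeaklyRegular.map_pow p rs hw)

lemma RingHom.finite_iff_exists_sum_eq {A B : Type*} [CommRing A] [CommRing B] {f : A →+* B} :
    f.Finite ↔ ∃ (n : ℕ) (t : Fin n → B), ∀ x, ∃ c : Fin n → A, ∑ i, f (c i) * t i = x := by
  algebraize_only [f]
  change Module.Finite A B ↔ _
  constructor
  · intro h
    obtain ⟨n, t, ht⟩ := Module.Finite.exists_fin (R := A) (M := B)
    refine ⟨n, t, fun x ↦ ?_⟩
    have hx : x ∈ Submodule.span A (Set.range t) := ht ▸ Submodule.mem_top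
    obtain ⟨c, hc⟩ := (Submodule.mem_span_range_iff_exists_fun A).mp hx
    exact ⟨c, by simp_rw [Algebra.smul_def] at hc; exact hc⟩
  · rintro ⟨n, t, ht⟩
    refine ⟨Submodule.fg_def.mpr ⟨Set.range t, Set.finite_range t, ?_⟩⟩
    refine eq_top_iff.mpr fun x _ ↦ (Submodule.mem_span_range_iff_exists_fun A).mpr ?_
    obtain ⟨c, hc⟩ := ht x
    exact ⟨c, by simp_rw [Algebra.smul_def]; exact hc⟩

/-- Localizations of `F`-finite rings are `F`-finite: as `r / s = (r s ^ (p - 1)) / s ^ p`, module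
generators for the Frobenius of `R` also generate for the Frobenius of a localization. -/
lemma RingHom.Finite.frobenius_of_isLocalization {R : Type*} [CommRing R] (p : ℕ) [ExpChar R p]
    (hF : (frobenius R p).Finite) (M : Submonoid R) (S : Type*) [CommRing S] [Algebra R S]
    [IsLocalization M S] [ExpChar S p] : (frobenius S p).Finite := by
  rw [RingHom.finite_iff_exists_sum_eq] at hF ⊢
  obtain ⟨n, t, ht⟩ := hF
  refine ⟨n, fun i ↦ algebraMap R S (t i), fun x ↦ ?_⟩
  obtain ⟨r, s, rfl⟩ := IsLocalization.exists_mk'_eq M x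
  obtain ⟨c, hc⟩ := ht (r * (s : R) ^ (p - 1))
  refine ⟨fun i ↦ IsLocalization.mk' S (c i) s, ?_⟩
  have hp : p - 1 + 1 = p := Nat.sub_add_cancel (expChar_pos R p)
  have hs : IsUnit (algebraMap R S s ^ p) := (IsLocalization.map_units S s).pow p
  refine hs.mul_left_cancel ?_
  have h1 : algebraMap R S s ^ p * IsLocalization.mk' S r s =
      algebraMap R S (r * (s : R) ^ (p - 1)) := by
    nth_rewrite 1 [← hp]
    rw [pow_succ, mul_assoc, IsLocalization.mk'_spec', map_mul, map_pow, mul_comm]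
  rw [h1, ← hc, map_sum, Finset.mul_sum]
  refine Finset.sum_congr rfl fun i _ ↦ ?_
  rw [frobenius_def, frobenius_def, ← mul_assoc, ← mul_pow, IsLocalization.mk'_spec', map_mul,
    map_pow]

/-- **Kunz's theorem**, for `F`-finite rings: the Frobenius of a regular ring is flat. -/
lemma IsRegularRing.flat_frobenius {R : Type*} [CommRing R] [IsRegularRing R] (p : ℕ)
    [Fact p.Prime] [CharP R p] (hF : (frobenius R p).Finite) : (frobenius R p).Flat := by
  refine RingHom.Flat.ofLocalizationPrime _ fun J hJ ↦ ?_
  have hcomap : J.comap (frobenius R p) = J := by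
    ext x
    exact hJ.pow_mem_iff_mem p (Fact.out : p.Prime).pos
  suffices ∀ (I : Ideal R) [I.IsPrime] (hI : I = J.comap (frobenius R p)), I = J →
      (Localization.localRingHom I J (frobenius R p) hI).Flat from this _ rfl hcomap
  rintro I _ hI rfl
  have : CharP (Localization.AtPrime I) p := by
    rw [CharP.charP_iff_prime_eq_zero Fact.out, ← map_natCast (algebraMap R _), CharP.cast_eq_zero,
      map_zero]
  have hfin := hF.frobenius_of_isLocalization p I.primeCompl (Localization.AtPrime I)
  rw [Localization.localRingHom_unique I I (frobenius R p) hI (j := frobenius _ p)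
    fun x ↦ by simp [frobenius_def]]
  exact IsRegularLocalRing.flat_frobenius p hfin

end FlatFrobenius

/-! ### Ideals extended along a finite flat ring homomorphism -/

section Extension

/-- If `s` splits the canonical surjection onto `B` from the free `A`-module on `B`, then membership
in an ideal of `B` extended from `A` is tested on the coordinates `s x b`. -/
lemma Ideal.mem_map_algebraMap_iff_of_linearCombination {A B : Type*} [CommRing A] [CommRing B]
    [Algebra A B] {s : B →ₗ[A] B →₀ A} (hs : Finsupp.linearCombination A id ∘ₗ s = .id)
    {J : Ideal A} {x : B} : x ∈ J.map (algebraMap A B) ↔ ∀ b, s x b ∈ J := by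
  constructor
  · intro hx b
    rw [← Submodule.restrictScalars_mem A, ← Ideal.smul_top_eq_map] at hx
    induction hx using Submodule.smul_induction_on' with
    | smul a ha y _ =>
      rw [map_smul, Finsupp.smul_apply]
      exact J.mul_mem_right _ ha
    | add y _ z _ hy hz =>
      rw [map_add, Finsupp.add_apply]
      exact J.add_mem hy hz
  · intro h
    rw [← LinearMap.id_apply (R := A) x, ← hs, LinearMap.comp_apply,
      Finsupp.linearCombination_apply]
    refine Ideal.sum_mem _ fun b _ ↦ ?_
    change s x b • b ∈ _
    rw [Algebra.smul_def]
    exact Ideal.mul_mem_right _ _ (Ideal.mem_map_of_mem _ (h b))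

lemma RingHom.Flat.projective_of_finite {A B : Type*} [CommRing A] [IsNoetherianRing A]
    [CommRing B] [Algebra A B] (hfin : (algebraMap A B).Finite) (hflat : (algebraMap A B).Flat) :
    Module.Projective A B := by
  rw [RingHom.finite_algebraMap] at hfin
  rw [RingHom.flat_algebraMap_iff] at hflat
  have := Module.finitePresentation_of_finite A B
  exact Module.Flat.projective_of_finitePresentation

/-- Extension of ideals along a finite flat homomorphism commutes with arbitrary intersections. -/
lemma Ideal.map_iInf_of_finite_of_flat {A B : Type*} [CommRing A] [IsNoetherianRing A]
    [CommRing B] {f : A →+* B} (hfin : f.Finite) (hflat : f.Flat) {ι : Sort*} (J : ι → Ideal A) :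
    (⨅ i, J i).map f = ⨅ i, (J i).map f := by
  algebraize_only [f]
  have := RingHom.Flat.projective_of_finite (A := A) (B := B) hfin hflat
  obtain ⟨s, hs⟩ := Module.projective_def'.mp this
  change (⨅ i, J i).map (algebraMap A B) = ⨅ i, (J i).map (algebraMap A B)
  ext x
  simp only [Ideal.mem_iInf, Ideal.mem_map_algebraMap_iff_of_linearCombination hs]
  exact forall_comm

/-- Extension of ideals along a finite flat homomorphism commutes with colons by an element. -/
lemma Ideal.map_colon_singleton_of_finite_of_flat {A B : Type*} [CommRing A] [IsNoetherianRing A]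
    [CommRing B] {f : A →+* B} (hfin : f.Finite) (hflat : f.Flat) (K : Ideal A) (u : A) :
    (K.colon {u}).map f = (K.map f).colon {f u} := by
  algebraize_only [f]
  have := RingHom.Flat.projective_of_finite (A := A) (B := B) hfin hflat
  obtain ⟨s, hs⟩ := Module.projective_def'.mp this
  change (K.colon {u}).map (algebraMap A B) = (K.map (algebraMap A B)).colon {algebraMap A B u}
  ext x
  have hux : x • algebraMap A B u = u • x := by
    rw [Algebra.smul_def u x, smul_eq_mul, mul_comm]
  simp only [Submodule.mem_colon_singleton, hux,
    Ideal.mem_map_algebraMap_iff_of_linearCombination hs, map_smul, Finsupp.smul_apply,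
    smul_eq_mul, mul_comm]

end Extension

/-! ### Two facts on Noetherian rings -/

section Noetherian

/-- A form of Krull's intersection theorem: an ideal contained in all powers of `I` is fixed by
multiplication with some element of `I`. -/
lemma Ideal.exists_mem_forall_mul_eq_of_forall_le_pow {R : Type*} [CommRing R] [IsNoetherianRing R]
    {a I : Ideal R} (h : ∀ n : ℕ, a ≤ I ^ n) : ∃ x ∈ I, ∀ y ∈ a, x * y = y := by
  obtain ⟨k, hk⟩ := I.exists_pow_inf_eq_pow_smul a
  have h1 : a ≤ I • a := by
    calc a ≤ I ^ (k + 1) • ⊤ ⊓ a := le_inf (by simpa using h (k + 1)) le_rfl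
      _ = I • (I ^ k • ⊤ ⊓ a) := by rw [hk (k + 1) k.le_succ, Nat.add_sub_cancel_left, pow_one]
      _ ≤ I • a := Submodule.smul_mono le_rfl inf_le_right
  simpa using Submodule.exists_mem_and_smul_eq_self_of_fg_of_le_smul I a
    a.fg_of_isNoetherianRing h1

lemma sInf_minimalPrimes_eq_bot (R : Type*) [CommRing R] [IsReduced R] :
    sInf (minimalPrimes R) = ⊥ := by
  rw [minimalPrimes, Ideal.sInf_minimalPrimes]
  exact nilradical_eq_zero R

/-- A minimal prime `P` of a reduced Noetherian ring is the annihilator of a single element: any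
`w ∉ P` that lies in all other minimal primes will do. -/
lemma Ideal.exists_eq_bot_colon_singleton_of_mem_minimalPrimes {R : Type*} [CommRing R]
    [IsNoetherianRing R] [IsReduced R] {P : Ideal R} (hP : P ∈ minimalPrimes R) :
    ∃ w : R, P = (⊥ : Ideal R).colon {w} := by
  classical
  have hPp := hP.1.1
  let s := ((minimalPrimes.finite_of_isNoetherianRing R).toFinset).erase P
  have hs : ¬ s.inf id ≤ P := by
    rw [hPp.inf_le']
    rintro ⟨Q, hQ, hQP⟩
    obtain ⟨hne, hQ⟩ := Finset.mem_erase.mp hQ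
    have hQ : Q ∈ minimalPrimes R := by simpa using hQ
    exact hne (le_antisymm hQP (hP.2 hQ.1 hQP))
  obtain ⟨w, hw, hwP⟩ := SetLike.not_le_iff_exists.mp hs
  refine ⟨w, le_antisymm (fun y hy ↦ ?_) fun y hy ↦ ?_⟩
  · rw [Submodule.mem_colon_singleton, smul_eq_mul, Submodule.mem_bot]
    have : y * w ∈ sInf (minimalPrimes R) := by
      refine Submodule.mem_sInf.mpr fun (Q : Ideal R) hQ ↦ ?_
      by_cases h : Q = P
      · exact h ▸ P.mul_mem_right _ hy
      · exact Q.mul_mem_left _ (Finset.inf_le (f := id) (Finset.mem_erase.mpr ⟨h, by simpa⟩) hw)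
    rwa [sInf_minimalPrimes_eq_bot] at this
  · rw [Submodule.mem_colon_singleton, smul_eq_mul, Submodule.mem_bot] at hy
    exact (hPp.mem_or_mem (hy ▸ P.zero_mem : y * w ∈ P)).resolve_right hwP

end Noetherian

namespace GenTestIdeal

/-! ### Frobenius powers and roots of ideals -/

section Brackets

variable {R : Type*} [CommRing R] {p : ℕ}

lemma bracketPow_eq_map [ExpChar R p] (J : Ideal R) (e : ℕ) :
    bracketPow J (p ^ e) = J.map (iterateFrobenius R p e) := by
  rw [bracketPow, Ideal.map]
  congr 1
  ext x
  simp [iterateFrobenius_def, eq_comm]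

lemma bracketPow_add [ExpChar R p] (J : Ideal R) (e k : ℕ) :
    bracketPow J (p ^ (e + k)) = bracketPow (bracketPow J (p ^ e)) (p ^ k) := by
  rw [bracketPow_eq_map, bracketPow_eq_map, bracketPow_eq_map, Ideal.map_map, add_comm,
    iterateFrobenius_add]

lemma bracketPow_le_pow (J : Ideal R) (q : ℕ) : bracketPow J q ≤ J ^ q := by
  rw [bracketPow, Ideal.span_le]
  rintro _ ⟨u, hu, rfl⟩
  exact Ideal.pow_mem_pow hu q

lemma bracketRoot_le {b J : Ideal R} {q : ℕ} (h : b ≤ bracketPow J q) : bracketRoot b q ≤ J :=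
  sInf_le h

lemma bracketRoot_mono {b b' : Ideal R} (h : b ≤ b') (q : ℕ) : bracketRoot b q ≤ bracketRoot b' q :=
  sInf_le_sInf fun _ hJ ↦ h.trans hJ

variable [IsRegularRing R] [Fact p.Prime] [CharP R p]

lemma flat_iterateFrobenius (hF : (frobenius R p).Finite) (e : ℕ) :
    (iterateFrobenius R p e).Finite ∧ (iterateFrobenius R p e).Flat := by
  induction e with
  | zero =>
    rw [iterateFrobenius_zero]
    exact ⟨RingHom.Finite.id R, RingHom.Flat.id R⟩
  | succ e ih =>
    rw [iterateFrobenius_add, iterateFrobenius_one]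
    exact ⟨ih.1.comp hF, (IsRegularRing.flat_frobenius p hF).comp ih.2⟩

lemma le_bracketPow_bracketRoot (hF : (frobenius R p).Finite) (b : Ideal R) (e : ℕ) :
    b ≤ bracketPow (bracketRoot b (p ^ e)) (p ^ e) := by
  obtain ⟨hfin, hflat⟩ := flat_iterateFrobenius hF e
  rw [bracketPow_eq_map, bracketRoot, sInf_eq_iInf', Ideal.map_iInf_of_finite_of_flat hfin hflat]
  refine le_iInf fun J ↦ ?_
  rw [← bracketPow_eq_map]
  exact J.2

lemma bracketPow_colon_singleton (hF : (frobenius R p).Finite) (K : Ideal R) (u : R) (e : ℕ) :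
    bracketPow (K.colon {u}) (p ^ e) = (bracketPow K (p ^ e)).colon {u ^ p ^ e} := by
  obtain ⟨hfin, hflat⟩ := flat_iterateFrobenius hF e
  rw [bracketPow_eq_map, bracketPow_eq_map, Ideal.map_colon_singleton_of_finite_of_flat hfin hflat,
    iterateFrobenius_def]

/-- Frobenius powers over a regular ring reflect membership: if `u ^ q ∈ K^{[q]}` then
`(K : u)^{[q]} = (K^{[q]} : u ^ q)` is the unit ideal, and hence so is `K : u`. -/
lemma mem_of_pow_mem_bracketPow (hF : (frobenius R p).Finite) {K : Ideal R} {u : R} {e : ℕ}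
    (h : u ^ p ^ e ∈ bracketPow K (p ^ e)) : u ∈ K := by
  have h1 : (1 : R) ∈ bracketPow (K.colon {u}) (p ^ e) := by
    rw [bracketPow_colon_singleton hF, Submodule.mem_colon_singleton]
    simpa using h
  have h2 := Ideal.pow_le_self (pow_pos (Fact.out : p.Prime).pos e).ne' (bracketPow_le_pow _ _ h1)
  rw [Submodule.mem_colon_singleton] at h2
  simpa using h2

lemma isReduced_of_isRegularRing (hF : (frobenius R p).Finite) : IsReduced R := by
  rw [isReduced_iff_pow_one_lt p (Fact.out : p.Prime).one_lt]
  intro u hu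
  refine (Submodule.mem_bot R).mp (mem_of_pow_mem_bracketPow hF (e := 1) ?_)
  rw [pow_one, hu]
  exact zero_mem _

/-- The ideals `(𝔞^r)^{[1/p^e]}` grow when `e` increases and `r / p ^ e` does not. -/
lemma bracketRoot_pow_le_bracketRoot_pow (hF : (frobenius R p).Finite) (a : Ideal R) {r s e k : ℕ}
    (h : s ≤ r * p ^ k) :
    bracketRoot (a ^ r) (p ^ e) ≤ bracketRoot (a ^ s) (p ^ (e + k)) := by
  refine bracketRoot_le fun u hu ↦ mem_of_pow_mem_bracketPow hF (e := k) ?_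
  rw [← bracketPow_add]
  refine le_bracketPow_bracketRoot hF _ _ (Ideal.pow_le_pow_right h ?_)
  rw [pow_mul]
  exact Ideal.pow_mem_pow hu _

end Brackets

/-! ### Test ideals -/

section TestIdeals

variable {R : Type*} [CommRing R]

lemma mem_zeroExp {a : Ideal R} {y : R} :
    y ∈ zeroExp a ↔ ∀ P ∈ minimalPrimes R, a ≤ P → y ∈ P := by
  simp only [zeroExp, Ideal.mem_iInf, zeroExpDomain]
  refine forall₂_congr fun P _ ↦ ?_
  have h : a.map (Ideal.Quotient.mk P) = ⊥ ↔ a ≤ P := by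
    rw [Ideal.map_eq_bot_iff_le_ker, Ideal.mk_ker]
  by_cases ha : a ≤ P
  · simp [h.mpr ha, ha, Ideal.Quotient.eq_zero_iff_mem]
  · simp [h.not.mpr ha, ha]

variable [IsRegularRing R] {p : ℕ} [Fact p.Prime] [CharP R p]

/-- If `(𝔞^(r p^k + 1))^{[1/p^(e+k)]} = I` for all large `k`, then `𝔞^r ⊆ I^{[p^e]}`, provided that
`r > 0`. With `K = I^{[p^e]}` and `u ∈ 𝔞^r` one gets `𝔞 ⊆ (K^{[p^k]} : u ^ p^k) = (K : u)^{[p^k]}`,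
so that `𝔞` lies in all powers of `K : u`, and Krull's intersection theorem applies. -/
lemma pow_le_bracketPow_of_eventually (hF : (frobenius R p).Finite) {a I : Ideal R} {r e k₀ : ℕ}
    (hr : r ≠ 0) (h : ∀ k ≥ k₀, bracketRoot (a ^ (r * p ^ k + 1)) (p ^ (e + k)) = I) :
    a ^ r ≤ bracketPow I (p ^ e) := by
  intro u hu
  set K := bracketPow I (p ^ e) with hK
  have hle : ∀ n : ℕ, a ≤ (K.colon {u}) ^ n := by
    intro n
    let k := max k₀ n
    have hn : n ≤ p ^ k :=
      (le_max_right _ _).trans (Nat.lt_pow_self (Fact.out : p.Prime).one_lt).le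
    refine le_trans (fun y hy ↦ ?_) ((bracketPow_le_pow _ (p ^ k)).trans (Ideal.pow_le_pow_right hn))
    rw [bracketPow_colon_singleton hF, Submodule.mem_colon_singleton, hK, ← bracketPow_add,
      ← h k (le_max_left _ _)]
    refine le_bracketPow_bracketRoot hF _ _ ?_
    rw [smul_eq_mul, mul_comm y, pow_succ, pow_mul]
    exact Ideal.mul_mem_mul (Ideal.pow_mem_pow hu _) hy
  obtain ⟨x, hx, hxa⟩ := Ideal.exists_mem_forall_mul_eq_of_forall_le_pow hle
  rw [Submodule.mem_colon_singleton, smul_eq_mul, hxa u (Ideal.pow_le_self hr hu)] at hx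
  exact hx

/-- The ideal `(𝔞)^{[1/p^k]}`, `k ≫ 0`, is the one prescribed for the exponent `0`. -/
lemma zeroExp_eq_of_eventually (hF : (frobenius R p).Finite) {a I : Ideal R} {k₀ : ℕ}
    (h : ∀ k ≥ k₀, bracketRoot a (p ^ k) = I) : zeroExp a = I := by
  have := isReduced_of_isRegularRing hF
  refine le_antisymm (fun y hy ↦ ?_) fun y hy ↦ mem_zeroExp.mpr fun P hP haP ↦ ?_
  · have hle : ∀ n : ℕ, a ≤ I ^ n := by
      intro n
      have hn : n ≤ p ^ max k₀ n :=
        (le_max_right _ _).trans (Nat.lt_pow_self (Fact.out : p.Prime).one_lt).le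
      have h1 := le_bracketPow_bracketRoot hF a (max k₀ n)
      rw [h _ (le_max_left _ _)] at h1
      exact h1.trans ((bracketPow_le_pow _ _).trans (Ideal.pow_le_pow_right hn))
    obtain ⟨x, hx, hxa⟩ := Ideal.exists_mem_forall_mul_eq_of_forall_le_pow hle
    -- `(1 - x) y` lies in every minimal prime `P`: if `𝔞 ⊈ P` then `1 - x ∈ P`, as `(1 - x) 𝔞 = 0`
    have h0 : (1 - x) * y ∈ sInf (minimalPrimes R) := by
      refine Submodule.mem_sInf.mpr fun (P : Ideal R) hP ↦ ?_
      by_cases haP : a ≤ P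
      · exact P.mul_mem_left _ (mem_zeroExp.mp hy P hP haP)
      · obtain ⟨z, hz, hzP⟩ := SetLike.not_le_iff_exists.mp haP
        refine P.mul_mem_right _ ((hP.1.1.mem_or_mem (?_ : (1 - x) * z ∈ P)).resolve_right hzP)
        rw [sub_mul, one_mul, hxa z hz, sub_self]
        exact P.zero_mem
    have h1 : (1 - x) * y = 0 := by rwa [sInf_minimalPrimes_eq_bot] at h0
    have h2 : y = x * y := by linear_combination h1
    exact h2 ▸ I.mul_mem_right _ hx
  · -- `P` is the annihilator of some `w`, hence `P ⊆ (0 : w ^ q) = (0 : w)^{[q]} = P^{[q]}`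
    rw [← h k₀ le_rfl] at hy
    refine bracketRoot_le (haP.trans fun z hz ↦ ?_) hy
    obtain ⟨w, rfl⟩ := Ideal.exists_eq_bot_colon_singleton_of_mem_minimalPrimes hP
    rw [bracketPow_colon_singleton hF, Submodule.mem_colon_singleton, smul_eq_mul]
    rw [Submodule.mem_colon_singleton, smul_eq_mul, Submodule.mem_bot] at hz
    obtain ⟨m, hm⟩ := Nat.exists_eq_succ_of_ne_zero (pow_pos (Fact.out : p.Prime).pos k₀).ne'
    rw [hm, pow_succ', ← mul_assoc, hz, zero_mul]
    exact zero_mem _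

/-- The defining chain of a test ideal is increasing, so its eventual value is the test ideal. -/
lemma testIdeal_eq_of_eventually (hF : (frobenius R p).Finite) {a I : Ideal R} {c : ℝ}
    (hc : 0 < c) {e₀ : ℕ}
    (h : ∀ e ≥ e₀, bracketRoot (a ^ ⌈c * (p : ℝ) ^ e⌉₊) (p ^ e) = I) : testIdeal p a c = I := by
  rw [testIdeal, if_neg hc.ne']
  refine le_antisymm (iSup₂_le fun e _ ↦ ?_) ?_
  · rw [← h (e + e₀) (Nat.le_add_left _ _)]
    refine bracketRoot_pow_le_bracketRoot_pow hF a (Nat.ceil_le.mpr ?_)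
    rw [pow_add, ← mul_assoc]
    push_cast
    gcongr
    exact Nat.le_ceil _
  · rw [← h (e₀ + 1) e₀.le_succ]
    exact le_iSup₂ (f := fun (e : ℕ) (_ : 0 < e) ↦ bracketRoot (a ^ ⌈c * (p : ℝ) ^ e⌉₊) (p ^ e))
      (e₀ + 1) e₀.succ_pos

/-- Just above `c`, the ideals `(𝔞^r)^{[1/p^e]}` do not depend on `r` and `e`. A maximal one among
those with `c < r / p ^ e`, say for `r₀` and `e₀`, is the common value: fractions in the interval
from `c` to the next multiple of `1 / p ^ e₀` have denominators with exponent `e > e₀`. -/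
lemma exists_forall_bracketRoot_eq (hF : (frobenius R p).Finite) (a : Ideal R) {c : ℝ}
    (hc : 0 ≤ c) :
    ∃ (I : Ideal R) (ε : ℝ), 0 < ε ∧ ∀ r e : ℕ, c < (r : ℝ) / (p : ℝ) ^ e →
      (r : ℝ) / (p : ℝ) ^ e < c + ε → bracketRoot (a ^ r) (p ^ e) = I := by
  have hp : (0 : ℝ) < p := by exact_mod_cast (Fact.out : p.Prime).pos
  let T : Set (Ideal R) :=
    {J | ∃ r e : ℕ, c < (r : ℝ) / (p : ℝ) ^ e ∧ bracketRoot (a ^ r) (p ^ e) = J}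
  have hT : T.Nonempty := ⟨_, ⌊c⌋₊ + 1, 0, by simpa using Nat.lt_floor_add_one c, rfl⟩
  obtain ⟨_, ⟨r₀, e₀, h₀, rfl⟩, hmax⟩ := set_has_maximal_iff_noetherian.mpr
    (inferInstanceAs (IsNoetherian R R)) T hT
  set N := ⌊c * (p : ℝ) ^ e₀⌋₊
  have hN : c * (p : ℝ) ^ e₀ < N + 1 := Nat.lt_floor_add_one _
  have hN' : (N : ℝ) ≤ c * (p : ℝ) ^ e₀ := Nat.floor_le (by positivity)
  refine ⟨bracketRoot (a ^ r₀) (p ^ e₀), (N + 1) / (p : ℝ) ^ e₀ - c, ?_, fun r e h1 h2 ↦ ?_⟩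
  · rwa [sub_pos, lt_div_iff₀ (by positivity)]
  rw [add_sub_cancel, div_lt_div_iff₀ (by positivity) (by positivity)] at h2
  have h1' := h1
  rw [lt_div_iff₀ (by positivity)] at h1 h₀
  have he : e₀ < e := by
    by_contra! hle
    obtain ⟨k, rfl⟩ := Nat.exists_eq_add_of_le hle
    rw [pow_add] at h2 hN'
    have h3 : (r : ℝ) * (p : ℝ) ^ k < N + 1 := by
      refine lt_of_mul_lt_mul_right (a := (p : ℝ) ^ e) ?_ (by positivity)
      linarith
    have h4 : r * p ^ k ≤ N := Nat.lt_succ_iff.mp (by exact_mod_cast h3)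
    have h5 : (r : ℝ) * (p : ℝ) ^ k ≤ N := by exact_mod_cast h4
    have h6 : c * (p : ℝ) ^ e * (p : ℝ) ^ k < r * (p : ℝ) ^ k := by gcongr
    linarith
  obtain ⟨k, rfl⟩ := Nat.exists_eq_add_of_le he.le
  have hr : r ≤ r₀ * p ^ k := by
    have h3 : N < r₀ := by exact_mod_cast hN'.trans_lt h₀
    have h4 : (N : ℝ) + 1 ≤ r₀ := by exact_mod_cast h3
    rw [pow_add] at h2
    have h5 : (r : ℝ) < r₀ * (p : ℝ) ^ k := by
      refine lt_of_mul_lt_mul_right (a := (p : ℝ) ^ e₀) ?_ (by positivity)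
      calc (r : ℝ) * (p : ℝ) ^ e₀ < (N + 1) * ((p : ℝ) ^ e₀ * (p : ℝ) ^ k) := h2
        _ ≤ r₀ * ((p : ℝ) ^ e₀ * (p : ℝ) ^ k) := by gcongr
        _ = r₀ * (p : ℝ) ^ k * (p : ℝ) ^ e₀ := by ring
    exact_mod_cast h5.le
  exact ((bracketRoot_pow_le_bracketRoot_pow hF a hr).eq_of_not_lt
    (hmax _ ⟨r, e₀ + k, h1', rfl⟩)).symm

/-- The common value of the ideals `(𝔞^r)^{[1/p^e]}` with `r / p ^ e` in an interval `(c, c + ε)` is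
the test ideal for all exponents in `[c, c + ε)`. -/
lemma testIdeal_eq_of_forall_bracketRoot_eq (hF : (frobenius R p).Finite) {a I : Ideal R}
    {c ε : ℝ} (hc : 0 ≤ c)
    (h : ∀ r e : ℕ, c < (r : ℝ) / (p : ℝ) ^ e → (r : ℝ) / (p : ℝ) ^ e < c + ε →
      bracketRoot (a ^ r) (p ^ e) = I) {c' : ℝ} (hcc' : c ≤ c') (hc' : c' < c + ε) :
    testIdeal p a c' = I := by
  have hp1 : (1 : ℝ) < p := by exact_mod_cast (Fact.out : p.Prime).one_lt
  have hp : (0 : ℝ) < p := by linarith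
  -- from here on, the interval `(c', c + ε)` takes the place of `(c, c + ε)`
  replace h : ∀ r e : ℕ, c' < (r : ℝ) / (p : ℝ) ^ e → (r : ℝ) / (p : ℝ) ^ e < c + ε →
      bracketRoot (a ^ r) (p ^ e) = I := fun r e h1 h2 ↦ h r e (hcc'.trans_lt h1) h2
  obtain ⟨e₀, he₀⟩ : ∃ e₀ : ℕ, ∀ e ≥ e₀, 2 / (p : ℝ) ^ e < c + ε - c' := by
    have h1 : Filter.Tendsto (fun e : ℕ ↦ 2 / (p : ℝ) ^ e) Filter.atTop (nhds 0) :=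
      (tendsto_pow_atTop_atTop_of_one_lt hp1).const_div_atTop 2
    exact Filter.eventually_atTop.mp (h1.eventually_lt_const (sub_pos.mpr hc'))
  rcases (hc.trans hcc').eq_or_lt with h0 | h0
  · subst h0
    rw [testIdeal, if_pos rfl]
    refine zeroExp_eq_of_eventually hF (k₀ := e₀) fun k hk ↦ ?_
    have := h 1 k (by positivity) (by
      have := he₀ k hk
      have h2 : ((1 : ℕ) : ℝ) / (p : ℝ) ^ k ≤ 2 / (p : ℝ) ^ k := by gcongr; norm_num
      linarith)
    rwa [pow_one] at this
  refine testIdeal_eq_of_eventually hF h0 (e₀ := e₀) fun e he ↦ ?_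
  set N := ⌈c' * (p : ℝ) ^ e⌉₊ with hN
  have hle : c' * (p : ℝ) ^ e ≤ N := Nat.le_ceil _
  have hlt : (N : ℝ) < c' * (p : ℝ) ^ e + 1 := Nat.ceil_lt_add_one (by positivity)
  -- for `k ≥ e₀`, `r / p ^ k` lies in the interval as soon as `c' p ^ k < r < c' p ^ k + 2`
  have key : ∀ (r k : ℕ), k ≥ e₀ → c' * (p : ℝ) ^ k < r → (r : ℝ) < c' * (p : ℝ) ^ k + 2 →
      bracketRoot (a ^ r) (p ^ k) = I := by
    intro r k hk h1 h2
    refine h r k ((lt_div_iff₀ (by positivity)).mpr h1) ?_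
    have h3 : (r : ℝ) / (p : ℝ) ^ k < c' + 2 / (p : ℝ) ^ k := by
      rw [div_lt_iff₀ (by positivity), add_mul, div_mul_cancel₀ _ (by positivity)]
      exact h2
    have := he₀ k hk
    linarith
  rcases hle.eq_or_lt with heq | hlt'
  · -- `c' = N / p ^ e` is a fraction, and lies itself outside the interval
    refine le_antisymm (bracketRoot_le ?_) ?_
    · refine pow_le_bracketPow_of_eventually hF (k₀ := 0) ?_ fun k _ ↦ key _ _ (by lia) ?_ ?_
      · rintro h1
        rw [h1] at heq
        have : 0 < c' * (p : ℝ) ^ e := by positivity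
        simp [heq] at this
      · push_cast
        rw [← heq, pow_add]
        linarith
      · push_cast
        rw [← heq, pow_add]
        linarith
    · rw [← key (N + 1) e he (by push_cast; linarith) (by push_cast; linarith)]
      exact bracketRoot_mono (Ideal.pow_le_pow_right N.le_succ) _
  · exact key N e he hlt' (by linarith)

end TestIdeals

end GenTestIdeal

theorem proposition2p9 {R : Type*} [CommRing R] [IsRegularRing R]
    (p : ℕ) [Fact p.Prime] [CharP R p] (hF : (frobenius R p).Finite)
    (a : Ideal R) (c : ℝ) (hc : 0 ≤ c) :
    ∃ ε : ℝ, 0 < ε ∧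
      (∀ r e : ℕ, c < (r : ℝ) / (p : ℝ) ^ e → (r : ℝ) / (p : ℝ) ^ e < c + ε →
        GenTestIdeal.testIdeal p a c = GenTestIdeal.bracketRoot (a ^ r) (p ^ e) ∧
        GenTestIdeal.testIdeal p a c = GenTestIdeal.testIdeal p a ((r : ℝ) / (p : ℝ) ^ e)) ∧
      (∀ c' : ℝ, c ≤ c' → c' < c + ε →
        GenTestIdeal.testIdeal p a c' = GenTestIdeal.testIdeal p a c) := by
  obtain ⟨I, ε, hε, h⟩ := GenTestIdeal.exists_forall_bracketRoot_eq hF a hc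
  have hτ : ∀ c' : ℝ, c ≤ c' → c' < c + ε → GenTestIdeal.testIdeal p a c' = I := fun c' h1 h2 ↦
    GenTestIdeal.testIdeal_eq_of_forall_bracketRoot_eq hF hc h h1 h2
  have hτc := hτ c le_rfl (by linarith)
  refine ⟨ε, hε, fun r e h1 h2 ↦ ⟨?_, ?_⟩, fun c' h1 h2 ↦ ?_⟩
  · rw [hτc, h r e h1 h2]
  · rw [hτc, hτ _ h1.le h2]
  · rw [hτc, hτ c' h1 h2]
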